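/- Let $n \ge 0$. A matrix path is a continuous map $\mathcal C:[0,1]\to M_n(\mathbb C)$, $\alpha\mapsto\mathcal C_\alpha$, and $\|A\|=\max_{i,j}|a_{i,j}|$. A $\mathcal C$-eigenpath set is a multiset $\{\gamma_1,\dots,\gamma_n\}$ of $n$ continuous functions $[0,1]\to\mathbb C$ such that for every $\alpha\in[0,1]$ the multiset $\{\gamma_1(\alpha),\dots,\gamma_n(\alpha)\}$ is the multiset of eigenvalues of $\mathcal C_\alpha$, counted with algebraic multiplicity. Theorem 2. Let $\varepsilon>0$ and let $\mathcal C$ be a matrix path with $\mathcal C$-eigenpath set $\{\gamma_1,\dots,\gamma_n\}$. Then there is a matrix path $\mathcal C'$ such that no $\mathcal C'_\alpha$ ($\alpha\in[0,1]$) has a repeated eigenvalue (that is, $\mathcal C'$ has no ambiguities), which admits exactly one $\mathcal C'$-eigenpath set, and the members of this set can be enumerated as $\gamma_1',\dots,\gamma_n'$ so that $\|\mathcal C_\alpha-\mathcal C'_\alpha\|<\varepsilon$ and $|\gamma_j(\alpha)-\gamma_j'(\alpha)|<\varepsilon$ for all $\alpha\in[0,1]$ and $j=1,\dots,n$. -/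

import Mathlib

namespace Eigenpath

/- Matrices carry the norm `‖A‖ = max_{i,j} |a_{i,j}|`. -/
attribute [local instance] Matrix.normedAddCommGroup

/-- A matrix path: a continuous function from `[0,1]` to the `n`-by-`n` complex matrices. -/
abbrev MatrixPath (n : ℕ) : Type := C(unitInterval, Matrix (Fin n) (Fin n) ℂ)

/-- The spectrum of a complex square matrix as a multiset of size `n`: the eigenvalues with
their algebraic multiplicities. -/
noncomputable def multisetSpectrum {n : ℕ} (A : Matrix (Fin n) (Fin n) ℂ) : Multiset ℂ :=
  A.charpoly.roots

/-- A multiset of `n` continuous functions `[0,1] → ℂ` is an eigenpath set of the matrix path `C`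
if at every `α` its values are the eigenvalues of `C α`, as multisets. -/
def IsEigenpathSet {n : ℕ} (C : MatrixPath n) (Γ : Multiset C(unitInterval, ℂ)) : Prop :=
  Multiset.card Γ = n ∧
    ∀ α : unitInterval, multisetSpectrum (C α) = Γ.map (fun γ => γ α)

/-- The multiset `{γ_1, ..., γ_n}` of the members of a family of paths. -/
def pathMultiset {n : ℕ} (γ : Fin n → C(unitInterval, ℂ)) : Multiset C(unitInterval, ℂ) :=
  (Finset.univ : Finset (Fin n)).val.map γ

/-- The eigenregion: all pairs `(l, α)` with `l` an eigenvalue of `C α`. -/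
def eigenregion {n : ℕ} (C : MatrixPath n) : Set (ℂ × unitInterval) :=
  {p | p.1 ∈ spectrum ℂ (C p.2)}

/-- An ambiguity: a point `(l, α)` of the eigenregion with `l` a repeated eigenvalue of `C α`. -/
def IsAmbiguity {n : ℕ} (C : MatrixPath n) (p : ℂ × unitInterval) : Prop :=
  p ∈ eigenregion C ∧ 2 ≤ (multisetSpectrum (C p.2)).count p.1

/-- The uniform condition `‖C α - C' α‖ < ε` for all `α`, in the norm `max_{i,j} |a_{i,j}|`. -/
def IsUniformlyClose {n : ℕ} (ε : ℝ) (C C' : MatrixPath n) : Prop :=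
  ∀ α : unitInterval, ‖C α - C' α‖ < ε

end Eigenpath

/-!
# Eigenpaths are uniform limits of eigenpaths without ambiguities

Let `X` be the set of pairs `(A, μ)` where `A` has no repeated eigenvalue and the tuple `μ` enumerates
its eigenvalues (`labelledSimple`). A matrix path with an eigenpath set is a path in the closure of
`X`, and the theorem asks for a uniformly close path in `X` itself. Subdividing the interval, such
a path exists as soon as `X` is locally joined along the given path (`exists_path_approx`): any two
points of `X` close to `(A, c)`, where `c` lists the eigenvalues of `A` with multiplicity, must be
joined by a path in `X` that stays close to `(A, c)`.

For this local statement (`IsLabelling.exists_joinedIn`), repeated eigenvalues on a complex line of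
matrices are cut out by one polynomial, so two matrices without repeated eigenvalues are joined by
a path of such matrices near `A` (`joinedIn_of_polynomial_line`). Simple eigenvalues can be followed
along it, and close to `A` none of them can leave the cluster around the corresponding entry of
`c` (`joinedIn_stays_near`). The labelling obtained at the end may however differ from the
prescribed one by a permutation inside the clusters. To undo it, one uses a continuous map `s` that
sends a tuple `ν` to a matrix with spectrum `ν`, is invariant under permutations of `ν`, and has
`s c` as close to `A` as desired (`IsLabelling.exists_spectral_section`): moving the points of
`ν ∘ σ` to those of `ν` without collisions gives under `s` a loop of matrices that realizes the
permutation.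

The section `s` is a conjugate of the companion matrix. It exists since a triangularization of `A`
can be perturbed, without changing the diagonal, so that the first row vector becomes cyclic
(`IsLabelling.exists_conj_companion_near`).

Finally, if the eigenvalues are distinct at every time, an eigenpath cannot jump between the
given ones because `[0,1]` is connected, so the eigenpath set is unique.
-/

namespace Eigenpath

/-! ### Approximating a path in the closure of a locally joined set -/

/-- A path in the closure of `X` can be approximated uniformly by paths in `X` as soon as any two
points of `X` close to a point of the path are joined within `X` by a path staying close to it. -/
theorem exists_path_approx {Y : Type*} [PseudoMetricSpace Y] (X : Set Y) (f : C(unitInterval, Y))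
    (hcl : ∀ α, f α ∈ closure X)
    (hj : ∀ α, ∀ ε > 0, ∃ δ > 0, ∀ x ∈ X, ∀ y ∈ X, dist x (f α) < δ → dist y (f α) < δ →
      JoinedIn (X ∩ Metric.ball (f α) ε) x y)
    {ε : ℝ} (hε : 0 < ε) :
    ∃ g : C(unitInterval, Y), (∀ t, g t ∈ X) ∧ ∀ t, dist (f t) (g t) < ε := by
  -- a joining radius that is uniform along the path
  obtain ⟨δ, hδ, hδε, H⟩ : ∃ δ > 0, δ ≤ ε ∧ ∀ t, ∀ x ∈ X, ∀ y ∈ X, dist x (f t) < δ →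
      dist y (f t) < δ → JoinedIn (X ∩ Metric.ball (f t) (ε / 2)) x y := by
    choose d hd hdj using fun α => hj α (ε / 4) (by positivity)
    obtain ⟨δ, hδ, h⟩ := lebesgue_number_lemma_of_metric (s := Set.range f)
      (c := fun α => Metric.ball (f α) (min (d α) (ε / 4)))
      (isCompact_range f.continuous) (fun _ => Metric.isOpen_ball) (by
        rintro _ ⟨α, rfl⟩
        exact Set.mem_iUnion.2 ⟨α, Metric.mem_ball_self (lt_min (hd α) (by positivity))⟩)
    refine ⟨min δ ε, lt_min hδ hε, min_le_right _ _, fun t x hx y hy hxt hyt => ?_⟩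
    obtain ⟨α, hα⟩ := h (f t) ⟨t, rfl⟩
    have key : ∀ z, dist z (f t) < min δ ε → dist z (f α) < min (d α) (ε / 4) :=
      fun z hz => hα (Metric.mem_ball.2 (hz.trans_le (min_le_left _ _)))
    have ht := key (f t) (by simpa using ⟨hδ, hε⟩)
    refine (hdj α x hx y hy ((key x hxt).trans_le (min_le_left _ _))
      ((key y hyt).trans_le (min_le_left _ _))).mono ?_
    rintro z ⟨hzX, hz⟩
    refine ⟨hzX, ?_⟩
    have h1 := ht.trans_le (min_le_right _ _)
    have h2 := dist_triangle_right z (f t) (f α)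
    rw [Metric.mem_ball] at hz ⊢
    linarith
  obtain ⟨η, hη, hfη⟩ := Metric.uniformContinuous_iff.1
    (CompactSpace.uniformContinuous_of_continuous f.continuous) (δ / 2) (by positivity)
  obtain ⟨N, hN⟩ := exists_nat_gt (1 / η)
  have hN0 : (0 : ℝ) < N := lt_trans (by positivity) hN
  -- the path, reparametrized so that the nodes of the subdivision are the integers
  let F : ℝ → Y := fun t => f (Set.projIcc 0 1 zero_le_one (t / N))
  have hF : ∀ (k t : ℝ), k ≤ t → t ≤ k + 1 → dist (F t) (F k) < δ / 2 := by
    intro k t h1 h2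
    apply hfη
    refine (Set.abs_projIcc_sub_projIcc (a := (0 : ℝ)) (b := 1) zero_le_one).trans_lt ?_
    rw [← sub_div, abs_of_nonneg (div_nonneg (by linarith) hN0.le), div_lt_iff₀ hN0]
    rw [div_lt_iff₀ hη] at hN
    nlinarith
  have hx : ∀ k : ℕ, ∃ x ∈ X, dist (F k) x < δ / 2 :=
    fun k => Metric.mem_closure_iff.1 (hcl _) _ (by positivity)
  choose x hxX hxd using hx
  have step : ∀ k : ℕ, ∃ g : ℝ → Y, Continuous g ∧ (∀ t, g t ∈ X) ∧
      (∀ t : ℝ, 0 ≤ t → t ≤ k → dist (F t) (g t) < ε) ∧ ∀ t, (k : ℝ) ≤ t → g t = x k := by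
    intro k
    induction k with
    | zero =>
      refine ⟨fun _ => x 0, continuous_const, fun _ => hxX 0, fun t h0 h1 => ?_, fun _ _ => rfl⟩
      obtain rfl : t = ((0 : ℕ) : ℝ) := by
        push_cast at h1 ⊢
        exact le_antisymm h1 h0
      exact (hxd 0).trans (by linarith)
    | succ k ih =>
      obtain ⟨g, hg, hgX, hgF, hgk⟩ := ih
      have hnext : dist (x (k + 1)) (F k) < δ := by
        have h1 := hF k (k + 1) (by linarith) le_rfl
        have h2 := hxd (k + 1)
        push_cast at h2
        rw [dist_comm] at h2
        linarith [dist_triangle (x (k + 1)) (F (k + 1)) (F k)]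
      obtain ⟨p, hp⟩ := H (Set.projIcc 0 1 zero_le_one ((k : ℝ) / N)) (x k) (hxX k) (x (k + 1))
        (hxX _) (by rw [dist_comm]; exact (hxd k).trans (by linarith)) hnext
      have hpe : ∀ t, p.extend t ∈ X ∩ Metric.ball (F k) (ε / 2) := fun t => hp _
      refine ⟨fun t => if t ≤ k then g t else p.extend (t - k), ?_, ?_, ?_, ?_⟩
      · refine Continuous.if_le hg (by fun_prop) continuous_id continuous_const ?_
        rintro t rfl
        simp [hgk]
      · intro t
        dsimp only
        split_ifs
        · exact hgX t
        · exact (hpe _).1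
      · intro t h0 h1
        dsimp only
        split_ifs with h
        · exact hgF t h0 h
        · have h2 := hF k t (by linarith) (by push_cast at h1; linarith)
          have h3 := (hpe (t - k)).2
          rw [Metric.mem_ball] at h3
          linarith [dist_triangle_right (F t) (p.extend (t - k)) (F k)]
      · intro t ht
        push_cast at ht
        have h : ¬ t ≤ k := by linarith
        simp only [h, if_false]
        exact p.extend_of_one_le (by linarith)
  obtain ⟨g, hg, hgX, hgF, -⟩ := step N
  refine ⟨⟨fun t => g (N * (t : ℝ)), by fun_prop⟩, fun t => hgX _, fun t => ?_⟩
  have := hgF (N * t) (mul_nonneg hN0.le t.2.1) (mul_le_of_le_one_right hN0.le t.2.2)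
  simpa [F, mul_div_cancel_left₀ _ hN0.ne'] using this

/-! ### Complex lines avoiding the zeros of a polynomial -/

/-- A bent segment through `1 / 2 + s * I`, for a suitable small real `s`, joins `0` to `1` inside a
convex open set and misses a given finite set. -/
theorem joinedIn_convex_diff_finite {V T : Set ℂ} (hV : IsOpen V) (hc : Convex ℝ V)
    (hT : T.Finite) (h0 : 0 ∈ V \ T) (h1 : 1 ∈ V \ T) : JoinedIn (V \ T) 0 1 := by
  let c : ℝ → ℂ := fun s => (1 / 2 : ℝ) + s * Complex.I
  have hcV : {s : ℝ | c s ∈ V} ∈ nhds (0 : ℝ) := by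
    have hcont : Continuous c := by fun_prop
    refine hcont.continuousAt.preimage_mem_nhds (hV.mem_nhds ?_)
    have := hc h0.1 h1.1 (a := 1 / 2) (b := 1 / 2) (by norm_num) (by norm_num) (by norm_num)
    simpa [c] using this
  obtain ⟨s, hsV, hsT⟩ := ((infinite_of_mem_nhds (0 : ℝ) hcV).sdiff
    ((hT.image fun τ : ℂ => τ.im / (2 * τ.re)).union
      (hT.image fun τ : ℂ => τ.im / (2 * (1 - τ.re))))).nonempty
  have hre : (c s).re = 1 / 2 := by simp [c]
  have him : (c s).im = s := by simp [c]
  refine (JoinedIn.of_segment_subset (y := c s) ?_).trans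
    (JoinedIn.of_segment_subset (y := c s) ?_).symm
  · intro τ hτ
    refine ⟨hc.segment_subset h0.1 hsV hτ, fun hτT => ?_⟩
    obtain ⟨a, b, ha, hb, hab, rfl⟩ := hτ
    rcases hb.eq_or_lt with rfl | hb
    · exact h0.2 (by simpa using hτT)
    · refine hsT (Or.inl ⟨_, hτT, ?_⟩)
      simp [hre, him]
      field_simp
  · intro τ hτ
    refine ⟨hc.segment_subset h1.1 hsV hτ, fun hτT => ?_⟩
    obtain ⟨a, b, ha, hb, hab, rfl⟩ := hτ
    rcases hb.eq_or_lt with rfl | hb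
    · obtain rfl : a = 1 := by linarith
      exact h1.2 (by simpa using hτT)
    · refine hsT (Or.inr ⟨_, hτT, ?_⟩)
      obtain rfl : a = 1 - b := by linarith
      simp [hre, him]
      field_simp
      ring_nf
      field_simp

/-- If a condition `P` holds on the complex line through `x` and `y` away from the zeros of a
polynomial, and holds in this way at `x` and `y`, then `x` and `y` are joined within `P` in every
convex open set containing them. -/
theorem joinedIn_of_polynomial_line {E : Type*} [NormedAddCommGroup E] [NormedSpace ℂ E]
    {B : Set E} (hB : IsOpen B) (hc : Convex ℝ B) {x y : E} (hx : x ∈ B) (hy : y ∈ B)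
    {P : E → Prop} (q : Polynomial ℂ)
    (hq : ∀ z : ℂ, q.eval z ≠ 0 ↔ P (x + z • (y - x))) (hPx : P x) (hPy : P y) :
    JoinedIn (B ∩ {w | P w}) x y := by
  let ℓ : ℂ → E := fun z => x + z • (y - x)
  have hℓ : Continuous ℓ := by fun_prop
  have hq0 : q.eval 0 ≠ 0 := (hq 0).2 (by simpa using hPx)
  have hq1 : q.eval 1 ≠ 0 := (hq 1).2 (by simpa using hPy)
  have hqne : q ≠ 0 := by
    rintro rfl
    simp at hq0
  have hconv : Convex ℝ (ℓ ⁻¹' B) := by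
    intro z hz w hw a b ha hb hab
    have := hc hz hw ha hb hab
    have e : a • ℓ z + b • ℓ w = ℓ (a • z + b • w) := by
      obtain rfl : a = 1 - b := by linarith
      simp only [ℓ, smul_add, add_smul, smul_assoc, sub_smul, one_smul]
      abel
    rw [e] at this
    exact this
  have key : JoinedIn (ℓ ⁻¹' B \ {z | q.IsRoot z}) 0 1 :=
    joinedIn_convex_diff_finite (hB.preimage hℓ) hconv (Polynomial.finite_setOfPred_isRoot hqne)
      ⟨by simpa [ℓ] using hx, hq0⟩ ⟨by simpa [ℓ] using hy, hq1⟩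
  have := JoinedIn.map key hℓ
  simp only [ℓ, zero_smul, add_zero, one_smul, add_sub_cancel] at this
  refine this.mono ?_
  rintro _ ⟨z, ⟨hzB, hzq⟩, rfl⟩
  exact ⟨hzB, (hq z).1 hzq⟩

open Polynomial

attribute [local instance] Matrix.normedAddCommGroup
attribute [local instance] Matrix.normedSpace

variable {n : ℕ}

/-! ### Labelled spectra -/

/-- The tuple `μ` lists the eigenvalues of `A` with their algebraic multiplicities. -/
def IsLabelling (A : Matrix (Fin n) (Fin n) ℂ) (μ : Fin n → ℂ) : Prop :=
  A.charpoly = ∏ i, (X - C (μ i))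

/-- The pairs of a matrix without repeated eigenvalues and an enumeration of its eigenvalues. -/
def labelledSimple (n : ℕ) : Set (Matrix (Fin n) (Fin n) ℂ × (Fin n → ℂ)) :=
  {p | IsLabelling p.1 p.2 ∧ Function.Injective p.2}

theorem IsLabelling.eval {A : Matrix (Fin n) (Fin n) ℂ} {μ : Fin n → ℂ} (h : IsLabelling A μ)
    (z : ℂ) : A.charpoly.eval z = ∏ i, (z - μ i) := by
  rw [h, eval_prod]
  simp

theorem IsLabelling.isRoot_iff {A : Matrix (Fin n) (Fin n) ℂ} {μ : Fin n → ℂ}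
    (h : IsLabelling A μ) {z : ℂ} : A.charpoly.IsRoot z ↔ ∃ i, z = μ i := by
  rw [IsRoot, h.eval, Finset.prod_eq_zero_iff]
  simp [sub_eq_zero]

theorem isLabelling_iff_roots {A : Matrix (Fin n) (Fin n) ℂ} {μ : Fin n → ℂ} :
    IsLabelling A μ ↔ A.charpoly.roots = (Finset.univ : Finset (Fin n)).val.map μ := by
  constructor
  · intro h
    rw [h, ← roots_multiset_prod_X_sub_C (Multiset.map μ _), Multiset.map_map]
    rfl
  · intro h
    rw [IsLabelling, ((IsAlgClosed.splits A.charpoly).eq_prod_roots_of_monic A.charpoly_monic), h,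
      Multiset.map_map]
    rfl

theorem isLabelling_of_isRoot {A : Matrix (Fin n) (Fin n) ℂ} {μ : Fin n → ℂ}
    (hμ : Function.Injective μ) (h : ∀ i, A.charpoly.IsRoot (μ i)) : IsLabelling A μ := by
  refine eq_of_monic_of_dvd_of_natDegree_le (monic_prod_of_monic _ _ fun i _ => monic_X_sub_C _)
    A.charpoly_monic ?_ ?_
  · exact Finset.prod_dvd_of_coprime (fun i _ j _ hij => pairwise_coprime_X_sub_C hμ hij)
      fun i _ => dvd_iff_isRoot.2 (h i)
  · rw [A.charpoly_natDegree_eq_dim]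
    simp

theorem IsLabelling.comp_perm {A : Matrix (Fin n) (Fin n) ℂ} {μ : Fin n → ℂ}
    (h : IsLabelling A μ) (σ : Equiv.Perm (Fin n)) : IsLabelling A (μ ∘ σ) := by
  rw [IsLabelling, h]
  exact (Equiv.prod_comp σ fun i => X - C (μ i)).symm

theorem IsLabelling.exists_perm {A : Matrix (Fin n) (Fin n) ℂ} {μ ν : Fin n → ℂ}
    (hμ : IsLabelling A μ) (hν : IsLabelling A ν) (hi : Function.Injective ν) :
    ∃ σ : Equiv.Perm (Fin n), ν = μ ∘ σ := by
  have h : ∀ i, ∃ j, ν i = μ j := fun i => hμ.isRoot_iff.1 (hν.isRoot_iff.2 ⟨i, rfl⟩)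
  choose s hs using h
  have hs' : Function.Injective s := fun i j hij => hi (by rw [hs, hs, hij])
  exact ⟨Equiv.ofBijective s (Finite.injective_iff_bijective.1 hs'), funext hs⟩

theorem exists_isLabelling (A : Matrix (Fin n) (Fin n) ℂ) : ∃ μ, IsLabelling A μ := by
  have hc : A.charpoly.roots.toList.length = n := by
    rw [Multiset.length_toList, ← (IsAlgClosed.splits A.charpoly).natDegree_eq_card_roots,
      A.charpoly_natDegree_eq_dim, Fintype.card_fin]
  refine ⟨fun i => A.charpoly.roots.toList.get (i.cast hc.symm), isLabelling_iff_roots.2 ?_⟩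
  rw [Fin.univ_val_map]
  conv_lhs => rw [← Multiset.coe_toList A.charpoly.roots]
  congr 1
  refine List.ext_get (by simp [hc]) fun i h1 h2 => by simp

theorem exists_mem_labelledSimple_iff {A : Matrix (Fin n) (Fin n) ℂ} :
    (∃ μ, (A, μ) ∈ labelledSimple n) ↔ A.charpoly.Separable := by
  constructor
  · rintro ⟨μ, h, hμ⟩
    have h' : A.charpoly = ∏ i, (X - C (μ i)) := h
    rw [h']
    exact separable_prod_X_sub_C_iff.2 hμ
  · intro h
    obtain ⟨μ, hμ⟩ := exists_isLabelling A
    refine ⟨μ, hμ, ?_⟩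
    have h' : A.charpoly = ∏ i, (X - C (μ i)) := hμ
    rw [h'] at h
    exact separable_prod_X_sub_C_iff.1 h

/-! ### Continuity of the roots of the characteristic polynomial -/

theorem continuous_eval_charpoly :
    Continuous fun p : Matrix (Fin n) (Fin n) ℂ × ℂ => p.1.charpoly.eval p.2 := by
  have : (fun p : Matrix (Fin n) (Fin n) ℂ × ℂ => p.1.charpoly.eval p.2) =
      fun p => (Matrix.diagonal (fun _ => p.2) - p.1).det := by
    funext p
    rw [Matrix.eval_charpoly]
    rfl
  rw [this]
  refine Continuous.matrix_det (Continuous.sub ?_ continuous_fst)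
  exact Continuous.matrix_diagonal (by fun_prop)

theorem norm_le_of_isRoot_charpoly {A : Matrix (Fin n) (Fin n) ℂ} {z : ℂ}
    (hz : A.charpoly.IsRoot z) : ‖z‖ ≤ ∑ i, ∑ j, ‖A i j‖ := by
  have h1 : Module.End.HasEigenvalue (Matrix.toLin' A) z := by
    rw [Module.End.hasEigenvalue_iff_isRoot_charpoly, Matrix.charpoly_toLin']
    exact hz
  obtain ⟨k, hk⟩ := eigenvalue_mem_ball h1
  rw [mem_closedBall_iff_norm] at hk
  have h2 : ‖z‖ ≤ ∑ j, ‖A k j‖ := by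
    rw [← Finset.add_sum_erase _ _ (Finset.mem_univ k)]
    linarith [norm_sub_norm_le z (A k k)]
  exact h2.trans (Finset.single_le_sum (f := fun i => ∑ j, ‖A i j‖)
    (fun i _ => Finset.sum_nonneg fun j _ => norm_nonneg _) (Finset.mem_univ k))

/-- Every eigenvalue of a matrix near `A` is close to an eigenvalue of `A`. -/
theorem IsLabelling.eventually_roots_near {A : Matrix (Fin n) (Fin n) ℂ} {μ : Fin n → ℂ}
    (h : IsLabelling A μ) {ε : ℝ} (hε : 0 < ε) :
    ∀ᶠ B in nhds A, ∀ z, B.charpoly.IsRoot z → ∃ j, ‖z - μ j‖ < ε := by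
  -- the region away from the `μ j` is made compact by a common bound for the eigenvalues near `A`
  let R : ℝ := ∑ i, ∑ j, ‖A i j‖ + 1
  have hR : ∀ᶠ B : Matrix (Fin n) (Fin n) ℂ in nhds A, ∑ i, ∑ j, ‖B i j‖ < R := by
    have hc : Continuous fun B : Matrix (Fin n) (Fin n) ℂ => ∑ i, ∑ j, ‖B i j‖ :=
      continuous_finsetSum _ fun i _ => continuous_finsetSum _ fun j _ =>
        (continuous_apply_apply i j).norm
    exact hc.continuousAt.eventually_lt continuousAt_const (lt_add_one _)
  let K : Set ℂ := Metric.closedBall 0 R ∩ {z | ∀ j, ε ≤ ‖z - μ j‖}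
  have hK : IsCompact K := (isCompact_closedBall _ _).inter_right (by
    simp only [Set.ofPred_forall]
    exact isClosed_iInter fun j => isClosed_le continuous_const (by fun_prop))
  have hne : ∀ᶠ B in nhds A, ∀ z ∈ K, B.charpoly.eval z ≠ 0 := by
    refine hK.eventually_forall_of_forall_eventually fun z hz => ?_
    have : A.charpoly.eval z ≠ 0 := fun h0 => by
      obtain ⟨j, rfl⟩ := h.isRoot_iff.1 h0
      have := hz.2 j
      simp at this
      linarith
    exact (continuous_eval_charpoly (n := n)).continuousAt.eventually_ne this
  filter_upwards [hR, hne] with B hBR hB z hz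
  by_contra! hcon
  exact hB z ⟨by simpa using (norm_le_of_isRoot_charpoly hz).trans hBR.le, hcon⟩ hz

/-- Every matrix near `A` has eigenvalues close to each of the eigenvalues of `A`. -/
theorem IsLabelling.eventually_exists_root_near {A : Matrix (Fin n) (Fin n) ℂ} {μ : Fin n → ℂ}
    (h : IsLabelling A μ) {r : ℝ} (hr : 0 < r) (i : Fin n) :
    ∀ᶠ B in nhds A, ∃ z, B.charpoly.IsRoot z ∧ ‖z - μ i‖ < r := by
  have h0 : ‖A.charpoly.eval (μ i)‖ < r ^ n := by
    have : A.charpoly.eval (μ i) = 0 := h.isRoot_iff.2 ⟨i, rfl⟩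
    rw [this, norm_zero]
    positivity
  have hc : Continuous fun B : Matrix (Fin n) (Fin n) ℂ => ‖B.charpoly.eval (μ i)‖ :=
    (continuous_eval_charpoly.comp (Continuous.prodMk_left (μ i))).norm
  filter_upwards [hc.continuousAt.eventually_lt continuousAt_const h0] with B hB
  by_contra! hcon
  refine hB.not_ge ?_
  obtain ⟨β, hβ⟩ := exists_isLabelling B
  rw [hβ.eval, norm_prod]
  calc r ^ n = ∏ _j : Fin n, r := by simp
    _ ≤ _ := Finset.prod_le_prod (fun _ _ => hr.le) fun j _ => by
      rw [norm_sub_rev]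
      exact hcon _ (hβ.isRoot_iff.2 ⟨j, rfl⟩)

/-- The discs of some radius around the distinct values of `μ` are pairwise disjoint. -/
theorem exists_gap {μ : Fin n → ℂ} :
    ∃ r > 0, ∀ i j, μ i ≠ μ j → 2 * r ≤ ‖μ i - μ j‖ := by
  have : ∀ p : Fin n × Fin n, ∃ r > 0, μ p.1 ≠ μ p.2 → 2 * r ≤ ‖μ p.1 - μ p.2‖ := by
    intro p
    by_cases hp : μ p.1 = μ p.2
    · exact ⟨1, one_pos, fun h => absurd hp h⟩
    · exact ⟨‖μ p.1 - μ p.2‖ / 2, half_pos (norm_pos_iff.2 (sub_ne_zero.2 hp)),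
        fun _ => by linarith⟩
  choose r hr h using this
  obtain ⟨r0, hr0, hle⟩ : ∃ r0 > 0, ∀ p, r0 ≤ r p := by
    refine ⟨(Finset.univ.image r ∪ {1}).min' (by simp), ?_, fun p => Finset.min'_le _ _ (by simp)⟩
    have := Finset.min'_mem (Finset.univ.image r ∪ {1}) (by simp)
    simp only [Finset.mem_union, Finset.mem_image, Finset.mem_univ, true_and,
      Finset.mem_singleton] at this
    rcases this with ⟨p, hp⟩ | h1
    · rw [← hp]
      exact hr p
    · rw [h1]
      exact one_pos
  exact ⟨r0, hr0, fun i j hij => by linarith [hle (i, j), h (i, j) hij]⟩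

/-- Simple eigenvalues can be followed continuously in a neighbourhood. -/
theorem exists_local_section {A : Matrix (Fin n) (Fin n) ℂ} {μ : Fin n → ℂ}
    (h : (A, μ) ∈ labelledSimple n) :
    ∃ δ > 0, ∃ m : Matrix (Fin n) (Fin n) ℂ → Fin n → ℂ, ContinuousOn m (Metric.ball A δ) ∧
      m A = μ ∧ ∀ B ∈ Metric.ball A δ, (B, m B) ∈ labelledSimple n := by
  classical
  obtain ⟨hA, hμ⟩ := h
  obtain ⟨r, hr, hgap⟩ := exists_gap (μ := μ)
  have hdisj : ∀ i j z, ‖z - μ i‖ < r → ‖z - μ j‖ < r → i = j := by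
    intro i j z hi hj
    by_contra hij
    have h1 := hgap i j (hμ.ne hij)
    have h2 := norm_sub_le_norm_sub_add_norm_sub (μ i) z (μ j)
    rw [norm_sub_rev (μ i) z] at h2
    linarith
  obtain ⟨δ, hδ, hball⟩ := Metric.eventually_nhds_iff_ball.1
    (Filter.eventually_all.2 fun i => hA.eventually_exists_root_near hr i)
  choose! m hm1 hm2 using hball
  have hlab : ∀ B ∈ Metric.ball A δ, (B, m B) ∈ labelledSimple n := by
    intro B hB
    have hinj : Function.Injective (m B) := fun i j hij =>
      hdisj i j (m B i) (hm2 B hB i) (by rw [hij]; exact hm2 B hB j)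
    exact ⟨isLabelling_of_isRoot hinj (hm1 B hB), hinj⟩
  have huniq : ∀ B ∈ Metric.ball A δ, ∀ z i, B.charpoly.IsRoot z → ‖z - μ i‖ < r → z = m B i := by
    intro B hB z i hz hzi
    obtain ⟨j, rfl⟩ := (hlab B hB).1.isRoot_iff.1 hz
    rw [hdisj i j _ hzi (hm2 B hB j)]
  refine ⟨δ, hδ, m, fun B hB => ContinuousAt.continuousWithinAt ?_, ?_, hlab⟩
  · refine continuousAt_pi.2 fun i => Metric.continuousAt_iff'.2 fun η hη => ?_
    have hpos : 0 < min η (r - ‖m B i - μ i‖) := lt_min hη (sub_pos.2 (hm2 B hB i))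
    filter_upwards [(hlab B hB).1.eventually_exists_root_near hpos i,
      Metric.isOpen_ball.mem_nhds hB] with B' ⟨z, hz, hzB⟩ hB'
    have h1 := hzB.trans_le (min_le_right _ _)
    have h2 := norm_sub_le_norm_sub_add_norm_sub z (m B i) (μ i)
    rw [← huniq B' hB' z i hz (by linarith), dist_eq_norm]
    exact hzB.trans_le (min_le_left _ _)
  · funext i
    exact (huniq A (Metric.mem_ball_self hδ) (μ i) i (hA.isRoot_iff.2 ⟨i, rfl⟩)
      (by simpa using hr)).symm

/-- Along the complex line through two matrices, having no repeated eigenvalue is the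
nonvanishing of a polynomial, namely of the resultant of the characteristic polynomial and its
derivative. -/
theorem exists_polynomial_line_separable (A B : Matrix (Fin n) (Fin n) ℂ) :
    ∃ q : ℂ[X], ∀ z : ℂ, q.eval z ≠ 0 ↔ (A + z • (B - A)).charpoly.Separable := by
  let M : Matrix (Fin n) (Fin n) ℂ[X] := A.map C + (X : ℂ[X]) • (B - A).map C
  have hM : ∀ z : ℂ, M.map (evalRingHom z) = A + z • (B - A) := by
    intro z
    ext i j
    simp [M]
  refine ⟨resultant M.charpoly (derivative M.charpoly) n (n - 1), fun z => ?_⟩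
  have hdeg : (A + z • (B - A)).charpoly.natDegree = n := by
    rw [Matrix.charpoly_natDegree_eq_dim, Fintype.card_fin]
  have h1 : (resultant M.charpoly (derivative M.charpoly) n (n - 1)).eval z =
      resultant (A + z • (B - A)).charpoly (derivative (A + z • (B - A)).charpoly) := by
    rw [natDegree_derivative, hdeg, ← hM z, ← coe_evalRingHom, Matrix.charpoly_map M (evalRingHom z),
      derivative_map, resultant_map_map]
  rw [h1, Ne, resultant_eq_zero_iff]
  simp [Separable, (Matrix.charpoly_monic _).ne_zero]

/-! ### Triangularization -/

/-- Every endomorphism of a finite-dimensional complex vector space has partial invariant flags. -/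
theorem exists_triangularizing_family {V : Type*} [AddCommGroup V] [Module ℂ V]
    [FiniteDimensional ℂ V] (f : Module.End ℂ V) (k : ℕ) (hk : k ≤ Module.finrank ℂ V) :
    ∃ b : Fin k → V, LinearIndependent ℂ b ∧
      ∀ j, f (b j) ∈ Submodule.span ℂ (b '' Set.Iic j) := by
  induction k with
  | zero => exact ⟨Fin.elim0, linearIndependent_empty_type, fun j => j.elim0⟩
  | succ k ih =>
    obtain ⟨b, hb, hf⟩ := ih (by omega)
    let W := Submodule.span ℂ (Set.range b)
    have hW : W ≤ W.comap f := by
      refine Submodule.span_le.2 ?_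
      rintro _ ⟨j, rfl⟩
      exact Submodule.span_mono (Set.image_subset_range _ _) (hf j)
    have hfr : Module.finrank ℂ W = k := by simpa using finrank_span_eq_card hb
    have hWne : W ≠ ⊤ := by
      intro h
      rw [h, finrank_top] at hfr
      omega
    have : Nontrivial (V ⧸ W) := Submodule.Quotient.nontrivial_iff.2 hWne
    -- a vector whose class spans an invariant line of the quotient extends the flag
    obtain ⟨c, hc⟩ := Module.End.exists_eigenvalue (W.mapQ W f hW)
    obtain ⟨w, hw, hw0⟩ := hc.exists_hasEigenvector
    obtain ⟨v, rfl⟩ := W.mkQ_surjective w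
    have hv : v ∉ W := fun h => hw0 (by simpa using h)
    have hfv : f v - c • v ∈ W := by
      have := Module.End.mem_eigenspace_iff.1 hw
      rw [Submodule.mkQ_apply, Submodule.mapQ_apply, ← Submodule.Quotient.mk_smul,
        Submodule.Quotient.eq] at this
      exact this
    refine ⟨Fin.snoc b v, linearIndependent_finSnoc.2 ⟨hb, hv⟩, fun j => ?_⟩
    refine Fin.lastCases ?_ (fun j => ?_) j
    · rw [Fin.snoc_last, ← sub_add_cancel (f v) (c • v)]
      refine Submodule.add_mem _ (Submodule.span_mono ?_ hfv)
        (Submodule.smul_mem _ _ (Submodule.subset_span ⟨Fin.last k, by simp, by simp⟩))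
      rintro _ ⟨i, rfl⟩
      exact ⟨i.castSucc, Fin.le_last _, by simp⟩
    · rw [Fin.snoc_castSucc]
      refine Submodule.span_mono ?_ (hf j)
      rintro _ ⟨i, hi, rfl⟩
      exact ⟨i.castSucc, by simpa using hi, by simp⟩

theorem exists_isUpperTriangular_conj (A : Matrix (Fin n) (Fin n) ℂ) :
    ∃ (P : (Matrix (Fin n) (Fin n) ℂ)ˣ) (T : Matrix (Fin n) (Fin n) ℂ),
      T.IsUpperTriangular ∧ A = P.val * T * P⁻¹.val := by
  obtain ⟨b, hb, hf⟩ := exists_triangularizing_family (Matrix.toLin' A) n (by simp)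
  let B : Module.Basis (Fin n) ℂ (Fin n → ℂ) :=
    basisOfLinearIndependentOfCardEqFinrank' b hb (by simp)
  have hB : ∀ j, B j = b j := fun j => by simp [B]
  let S := Pi.basisFun ℂ (Fin n)
  refine ⟨⟨S.toMatrix B, B.toMatrix S, S.toMatrix_mul_toMatrix_flip B,
    B.toMatrix_mul_toMatrix_flip S⟩, LinearMap.toMatrix B B (Matrix.toLin' A), ?_, ?_⟩
  · intro i j hij
    rw [LinearMap.toMatrix_apply]
    by_contra hne
    have h := hf j
    rw [← hB, show b = B from funext fun j => (hB j).symm, B.mem_span_image] at h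
    exact absurd (h (Finsupp.mem_support_iff.2 hne)) (not_le.2 hij)
  · have := basis_toMatrix_mul_linearMap_toMatrix_mul_basis_toMatrix S B S B (Matrix.toLin' A)
    refine Eq.trans ?_ this.symm
    simp [S, LinearMap.toMatrix_eq_toMatrix']

/-! ### Companion matrices -/

/-- The companion matrix of the polynomial with root tuple `μ`, with ones above the diagonal and
the negated coefficients in the last row. -/
noncomputable def companion (μ : Fin n → ℂ) : Matrix (Fin n) (Fin n) ℂ :=
  Matrix.of fun i j => if (i : ℕ) + 1 < n then (if (j : ℕ) = i + 1 then 1 else 0)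
    else -(∏ k, (X - C (μ k))).coeff j

/-- The companion matrix acts as a shift on every sequence satisfying the linear recurrence given
by the polynomial. -/
theorem companion_sum_smul {M : Type*} [AddCommGroup M] [Module ℂ M] (μ : Fin n → ℂ) (r : ℕ → M)
    (hr : ∑ j ∈ Finset.range (n + 1), (∏ k, (X - C (μ k))).coeff j • r j = 0) (i : Fin n) :
    ∑ j, companion μ i j • r j = r (i + 1) := by
  by_cases hi : (i : ℕ) + 1 < n
  · rw [Finset.sum_eq_single (⟨i + 1, hi⟩ : Fin n)]
    · simp [companion, hi]
    · intro j _ hj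
      have : (j : ℕ) ≠ i + 1 := fun h => hj (Fin.ext h)
      simp [companion, hi, this]
    · simp
  · have hin : (i : ℕ) + 1 = n := by omega
    have hlead : (∏ k, (X - C (μ k))).coeff n = 1 := by
      have := (monic_prod_of_monic Finset.univ (fun k => X - C (μ k))
        fun k _ => monic_X_sub_C _).coeff_natDegree
      simpa using this
    rw [Finset.sum_range_succ, hlead, one_smul, Finset.sum_range] at hr
    simp only [companion, Matrix.of_apply, hi, if_false, neg_smul, Finset.sum_neg_distrib]
    rw [hin]
    exact neg_eq_of_add_eq_zero_right hr

theorem companion_comp_perm (μ : Fin n → ℂ) (σ : Equiv.Perm (Fin n)) :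
    companion (μ ∘ σ) = companion μ := by
  simp only [companion, Function.comp_apply, Equiv.prod_comp σ fun i => X - C (μ i)]

theorem continuous_companion : Continuous (companion (n := n)) := by
  refine continuous_matrix fun i j => ?_
  have hcoeff : Continuous fun μ : Fin n → ℂ => (∏ k, (X - C (μ k))).coeff (j : ℕ) := by
    have : (fun μ : Fin n → ℂ => (∏ k, (X - C (μ k))).coeff (j : ℕ)) = fun μ =>
        MvPolynomial.eval μ ((∏ k, (X - C (MvPolynomial.X k : MvPolynomial (Fin n) ℂ))).coeff j) := by
      funext μ
      rw [← coeff_map, Polynomial.map_prod]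
      simp
    rw [this]
    exact MvPolynomial.continuous_eval _
  simp only [companion, Matrix.of_apply]
  split_ifs
  · exact continuous_const
  · exact continuous_const
  · exact hcoeff.neg

/-- The transposed Vandermonde matrix diagonalizes the companion matrix when the roots are
distinct. -/
theorem isLabelling_companion {μ : Fin n → ℂ} (hμ : Function.Injective μ) :
    IsLabelling (companion μ) μ := by
  have hV : IsUnit (Matrix.vandermonde μ).transpose := by
    rw [Matrix.isUnit_iff_isUnit_det, Matrix.det_transpose, isUnit_iff_ne_zero]
    exact Matrix.det_vandermonde_ne_zero_iff.2 hμ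
  obtain ⟨V, hV⟩ := hV
  have hmul : companion μ * V.val = V.val * Matrix.diagonal μ := by
    ext i k
    have hroot : (∏ k, (X - C (μ k))).eval (μ k) = 0 := by
      rw [eval_prod]
      exact Finset.prod_eq_zero (Finset.mem_univ k) (by simp)
    have := companion_sum_smul μ (fun m => μ k ^ m) (by
      rw [eval_eq_sum_range' (n := n + 1) (by simp)] at hroot
      simpa using hroot) i
    rw [Matrix.mul_diagonal, Matrix.mul_apply, hV]
    simpa [Matrix.vandermonde_apply, pow_succ] using this
  have hconj : companion μ = V.val * Matrix.diagonal μ * V⁻¹.val := by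
    rw [← hmul, mul_assoc, Units.mul_inv, mul_one]
  rw [IsLabelling, hconj, Matrix.coe_units_inv, Matrix.charpoly_units_conj,
    Matrix.charpoly_diagonal]

/-! ### Cyclic vectors -/

/-- The matrix with rows `e₀ T ^ k`, where `e₀` is the first standard row vector. It is invertible
exactly when `e₀` is a cyclic vector of `T`. -/
def krylov {R : Type*} [CommRing R] {m : ℕ} (T : Matrix (Fin (m + 1)) (Fin (m + 1)) R) :
    Matrix (Fin (m + 1)) (Fin (m + 1)) R :=
  Matrix.of fun k => (T ^ (k : ℕ)) 0

theorem krylov_map {R S : Type*} [CommRing R] [CommRing S] {m : ℕ} (f : R →+* S)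
    (T : Matrix (Fin (m + 1)) (Fin (m + 1)) R) : krylov (T.map f) = (krylov T).map f := by
  ext i j
  have := congrFun (congrFun (map_pow f.mapMatrix T i) 0) j
  exact this.symm

theorem krylov_smul {R : Type*} [CommRing R] {m : ℕ} (c : R)
    (T : Matrix (Fin (m + 1)) (Fin (m + 1)) R) :
    krylov (c • T) = Matrix.diagonal (fun k : Fin (m + 1) => c ^ (k : ℕ)) * krylov T := by
  ext i j
  simp [krylov, _root_.smul_pow, Matrix.diagonal_mul]

/-- The nilpotent matrix with ones just above the diagonal. -/
def superdiagonal (n : ℕ) : Matrix (Fin n) (Fin n) ℂ :=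
  Matrix.of fun i j => if (j : ℕ) = i + 1 then 1 else 0

theorem krylov_superdiagonal (m : ℕ) : krylov (superdiagonal (m + 1)) = 1 := by
  have h : ∀ (k : ℕ) (j : Fin (m + 1)),
      (superdiagonal (m + 1) ^ k) 0 j = if (j : ℕ) = k then 1 else 0 := by
    intro k
    induction k with
    | zero =>
      intro j
      simp only [pow_zero, Matrix.one_apply]
      exact if_congr (by rw [eq_comm, Fin.ext_iff, Fin.val_zero]) rfl rfl
    | succ k ih =>
      intro j
      simp only [pow_succ, Matrix.mul_apply, ih, ite_mul, one_mul, zero_mul]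
      simp only [superdiagonal, Matrix.of_apply]
      split_ifs with hj
      · rw [Finset.sum_eq_single (⟨k, by omega⟩ : Fin (m + 1))]
        · simp [hj]
        · intro l _ hl
          have : (l : ℕ) ≠ k := fun h => hl (Fin.ext h)
          simp [this]
        · simp
      · refine Finset.sum_eq_zero fun l _ => ?_
        split_ifs with h1 h2
        · omega
        · rfl
        · rfl
  ext i j
  simp [krylov, h, Matrix.one_apply, Fin.ext_iff, eq_comm]

/-- A matrix with a cyclic vector is similar to the companion matrix of its characteristic
polynomial, by the Cayley–Hamilton theorem. -/
theorem krylov_mul {m : ℕ} {T : Matrix (Fin (m + 1)) (Fin (m + 1)) ℂ} {μ : Fin (m + 1) → ℂ}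
    (hμ : IsLabelling T μ) : krylov T * T = companion μ * krylov T := by
  have hCH : ∑ j ∈ Finset.range (m + 1 + 1), (∏ k, (X - C (μ k))).coeff j • T ^ j = 0 := by
    have h := T.aeval_self_charpoly
    have h' : T.charpoly = ∏ k, (X - C (μ k)) := hμ
    rwa [h', aeval_eq_sum_range' (n := m + 1 + 1) (by simp)] at h
  ext i j
  have h := companion_sum_smul μ (fun k => (T ^ k) 0) (by
    ext l
    have := congrFun (congrFun hCH 0) l
    simpa [Matrix.sum_apply, Finset.sum_apply] using this) i
  have h' := congrFun h j
  rw [Matrix.mul_apply, Matrix.mul_apply]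
  simp only [Finset.sum_apply, Pi.smul_apply, smul_eq_mul] at h'
  rw [pow_succ, Matrix.mul_apply] at h'
  exact h'.symm

/-- Arbitrarily small multiples of the superdiagonal matrix make the first row vector cyclic: up to
scaling, `T + z • S` equals `z⁻¹ • T + S`, for which cyclicity is a polynomial condition on `z⁻¹`
that holds at `z⁻¹ = 0`. -/
theorem finite_not_cyclic {m : ℕ} (T : Matrix (Fin (m + 1)) (Fin (m + 1)) ℂ) :
    {z : ℂ | (krylov (T + z • superdiagonal (m + 1))).det = 0}.Finite := by
  let S := superdiagonal (m + 1)
  let M : Matrix (Fin (m + 1)) (Fin (m + 1)) ℂ[X] := (X : ℂ[X]) • T.map C + S.map C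
  have hM : ∀ w : ℂ, M.map (evalRingHom w) = w • T + S := by
    intro w
    ext i j
    simp only [M, Matrix.map_apply, Matrix.add_apply, Matrix.smul_apply, smul_eq_mul, eval_add, eval_mul,
      coe_evalRingHom, eval_X, eval_C]
  have heval : ∀ w : ℂ, (krylov M).det.eval w = (krylov (w • T + S)).det := by
    intro w
    rw [← hM, krylov_map, ← coe_evalRingHom, RingHom.map_det]
    rfl
  have hne : (krylov M).det ≠ 0 := by
    intro h
    have := heval 0
    rw [h, zero_smul, zero_add, krylov_superdiagonal, Matrix.det_one] at this
    simp at this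
  refine (((finite_setOfPred_isRoot hne).image fun w => w⁻¹).insert 0).subset fun z hz => ?_
  rcases eq_or_ne z 0 with rfl | hz0
  · exact Or.inl rfl
  · refine Or.inr ⟨z⁻¹, ?_, inv_inv z⟩
    have hsmul : T + z • S = z • (z⁻¹ • T + S) := by
      rw [smul_add, smul_smul, mul_inv_cancel₀ hz0, one_smul]
    have hz' : (krylov (T + z • S)).det = 0 := hz
    rw [hsmul, krylov_smul, Matrix.det_mul, Matrix.det_diagonal, mul_eq_zero] at hz'
    refine (heval _).trans (hz'.resolve_left ?_)
    exact Finset.prod_ne_zero_iff.2 fun k _ => pow_ne_zero _ hz0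

/-- A matrix is a limit of matrices with the same characteristic polynomial that are similar to its
companion matrix. -/
theorem IsLabelling.exists_conj_companion_near {A : Matrix (Fin n) (Fin n) ℂ} {μ : Fin n → ℂ}
    (h : IsLabelling A μ) {ε : ℝ} (hε : 0 < ε) :
    ∃ Q : (Matrix (Fin n) (Fin n) ℂ)ˣ, ‖Q.val * companion μ * Q⁻¹.val - A‖ < ε := by
  cases n with
  | zero => exact ⟨1, by rwa [Subsingleton.elim (_ - A) 0, norm_zero]⟩
  | succ m =>
    obtain ⟨P, T, hT, rfl⟩ := exists_isUpperTriangular_conj A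
    let S := superdiagonal (m + 1)
    have hcont : Continuous fun z : ℂ => P.val * (T + z • S) * P⁻¹.val := by fun_prop
    have hnear : ∀ᶠ z : ℂ in nhds 0,
        ‖P.val * (T + z • S) * P⁻¹.val - P.val * T * P⁻¹.val‖ < ε := by
      have := Metric.tendsto_nhds.1 (hcont.tendsto 0) ε hε
      simpa [dist_eq_norm] using this
    obtain ⟨z, hz, hdet⟩ :=
      ((infinite_of_mem_nhds (0 : ℂ) hnear).sdiff (finite_not_cyclic T)).nonempty
    have hTz : (T + z • S).IsUpperTriangular := by
      intro i j hij
      have hij' : (j : ℕ) < i := hij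
      have : (j : ℕ) ≠ i + 1 := by omega
      simp [hT hij, S, superdiagonal, this]
    have hlab : IsLabelling (T + z • S) μ := by
      have h1 : (P.val * T * P⁻¹.val).charpoly = ∏ i, (X - C (μ i)) := h
      rw [Matrix.coe_units_inv, Matrix.charpoly_units_conj,
        Matrix.charpoly_of_isUpperTriangular T hT] at h1
      rw [IsLabelling, Matrix.charpoly_of_isUpperTriangular _ hTz, ← h1]
      refine Finset.prod_congr rfl fun i _ => ?_
      simp [S, superdiagonal]
    obtain ⟨K, hK⟩ : IsUnit (krylov (T + z • S)) := by
      rw [Matrix.isUnit_iff_isUnit_det, isUnit_iff_ne_zero]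
      exact hdet
    have hconj : T + z • S = K⁻¹.val * companion μ * K.val := by
      rw [mul_assoc, hK, ← krylov_mul hlab, ← hK, Units.inv_mul_cancel_left]
    refine ⟨P * K⁻¹, ?_⟩
    have hz' : ‖P.val * (T + z • S) * P⁻¹.val - P.val * T * P⁻¹.val‖ < ε := hz
    rw [hconj] at hz'
    simpa [mul_assoc] using hz'

/-- Near every matrix `A` with spectrum `μ` there is a continuous choice of matrices with
prescribed distinct eigenvalues, depending only on the set of eigenvalues. -/
theorem IsLabelling.exists_spectral_section {A : Matrix (Fin n) (Fin n) ℂ} {μ : Fin n → ℂ}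
    (h : IsLabelling A μ) {ε : ℝ} (hε : 0 < ε) :
    ∃ s : (Fin n → ℂ) → Matrix (Fin n) (Fin n) ℂ, Continuous s ∧ ‖s μ - A‖ < ε ∧
      (∀ ν, Function.Injective ν → IsLabelling (s ν) ν) ∧
      ∀ ν (σ : Equiv.Perm (Fin n)), s (ν ∘ σ) = s ν := by
  obtain ⟨Q, hQ⟩ := h.exists_conj_companion_near hε
  refine ⟨fun ν => Q.val * companion ν * Q⁻¹.val, ?_, hQ, fun ν hν => ?_, fun ν σ => ?_⟩
  · exact (continuous_const.mul continuous_companion).mul continuous_const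
  · rw [IsLabelling, Matrix.coe_units_inv, Matrix.charpoly_units_conj]
    exact isLabelling_companion hν
  · simp only [companion_comp_perm]

/-! ### Moving distinct points of the plane -/

theorem exists_injective_near (μ : Fin n → ℂ) {δ : ℝ} (hδ : 0 < δ) :
    ∃ ν : Fin n → ℂ, Function.Injective ν ∧ dist ν μ < δ := by
  let ℓ : ℂ → Fin n → ℂ := fun z i => μ i + z * i
  have hℓ : Continuous ℓ := by fun_prop
  have hnear : ∀ᶠ z in nhds 0, dist (ℓ z) μ < δ := by
    have := Metric.tendsto_nhds.1 (hℓ.tendsto 0) δ hδ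
    simpa [ℓ] using this
  obtain ⟨z, hz, hzb⟩ := ((infinite_of_mem_nhds (0 : ℂ) hnear).sdiff (Set.finite_range
    fun p : Fin n × Fin n => (μ p.1 - μ p.2) / ((p.2 : ℂ) - p.1))).nonempty
  refine ⟨ℓ z, fun i j hij => ?_, hz⟩
  by_contra hne
  refine hzb ⟨(i, j), ?_⟩
  have : ((j : ℕ) : ℂ) - (i : ℕ) ≠ 0 := by
    rw [sub_ne_zero, Ne, Nat.cast_inj]
    exact fun h => hne (Fin.ext h.symm)
  rw [div_eq_iff this]
  simp only [ℓ] at hij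
  linear_combination hij

/-- Two tuples of distinct points close to `c` are joined by tuples of distinct points. -/
theorem joinedIn_injective {c μ ν : Fin n → ℂ} {δ : ℝ} (hμ : Function.Injective μ)
    (hν : Function.Injective ν) (hμc : μ ∈ Metric.ball c δ) (hνc : ν ∈ Metric.ball c δ) :
    JoinedIn (Metric.ball c δ ∩ {τ | Function.Injective τ}) μ ν := by
  refine joinedIn_of_polynomial_line Metric.isOpen_ball (convex_ball c δ) hμc hνc
    (Matrix.vandermonde fun i => C (μ i) + X * C (ν i - μ i)).det (fun z => ?_) hμ hν
  rw [← Matrix.det_vandermonde_ne_zero_iff, ← coe_evalRingHom, RingHom.map_det]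
  have : (evalRingHom z).mapMatrix (Matrix.vandermonde fun i => C (μ i) + X * C (ν i - μ i)) =
      Matrix.vandermonde (μ + z • (ν - μ)) := by
    ext i j
    simp [Matrix.vandermonde_apply]
  rw [this]

/-! ### Following the eigenvalues along a path of matrices without repeated eigenvalues -/

theorem exists_joinedIn_nearby {U : Set (Matrix (Fin n) (Fin n) ℂ)} (hU : IsOpen U)
    {A : Matrix (Fin n) (Fin n) ℂ} {μ : Fin n → ℂ} (h : (A, μ) ∈ labelledSimple n) (hA : A ∈ U) :
    ∀ᶠ B in nhds A, ∃ ν, JoinedIn (labelledSimple n ∩ {p | p.1 ∈ U}) (A, μ) (B, ν) := by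
  obtain ⟨δ, hδ, m, hm, hmA, hmB⟩ := exists_local_section h
  obtain ⟨η, hη, hηU⟩ := Metric.isOpen_iff.1 hU A hA
  filter_upwards [Metric.ball_mem_nhds A (lt_min hδ hη)] with B hB
  refine ⟨m B, ?_⟩
  have hj : JoinedIn (Metric.ball A (min δ η)) A B := JoinedIn.of_segment_subset
    ((convex_ball A _).segment_subset (Metric.mem_ball_self (lt_min hδ hη)) hB)
  have hsub : Metric.ball A (min δ η) ⊆ Metric.ball A δ := Metric.ball_subset_ball (min_le_left _ _)
  have := hj.map_continuousOn (f := fun B => (B, m B)) (continuousOn_id.prodMk (hm.mono hsub))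
  rw [hmA] at this
  refine this.mono ?_
  rintro _ ⟨B', hB', rfl⟩
  exact ⟨hmB B' (hsub hB'), hηU (Metric.ball_subset_ball (min_le_right _ _) hB')⟩

theorem joinedIn_comp_perm {U : Set (Matrix (Fin n) (Fin n) ℂ)}
    {p q : Matrix (Fin n) (Fin n) ℂ × (Fin n → ℂ)}
    (h : JoinedIn (labelledSimple n ∩ {p | p.1 ∈ U}) p q) (σ : Equiv.Perm (Fin n)) :
    JoinedIn (labelledSimple n ∩ {p | p.1 ∈ U}) (p.1, p.2 ∘ σ) (q.1, q.2 ∘ σ) := by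
  have := h.map (f := fun p : Matrix (Fin n) (Fin n) ℂ × (Fin n → ℂ) => (p.1, p.2 ∘ σ))
    (by unfold Function.comp; fun_prop)
  refine this.mono ?_
  rintro _ ⟨p, ⟨hp, hpU⟩, rfl⟩
  exact ⟨⟨hp.1.comp_perm σ, hp.2.comp σ.injective⟩, hpU⟩

/-- The times at which a path of matrices without repeated eigenvalues can be reached from a
given labelling of its starting matrix form an open and closed set. -/
theorem exists_joinedIn_of_joinedIn_separable {U : Set (Matrix (Fin n) (Fin n) ℂ)} (hU : IsOpen U)
    {A B : Matrix (Fin n) (Fin n) ℂ} {μ : Fin n → ℂ} (h : (A, μ) ∈ labelledSimple n)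
    (hAB : JoinedIn (U ∩ {M | M.charpoly.Separable}) A B) :
    ∃ ν, JoinedIn (labelledSimple n ∩ {p | p.1 ∈ U}) (A, μ) (B, ν) := by
  obtain ⟨g, hg⟩ := hAB
  let S : Set unitInterval :=
    {t | ∃ ν, JoinedIn (labelledSimple n ∩ {p | p.1 ∈ U}) (A, μ) (g t, ν)}
  have hopen : IsOpen S := by
    refine isOpen_iff_mem_nhds.2 fun t ⟨ν, hν⟩ => ?_
    have := g.continuous.continuousAt.eventually
      (exists_joinedIn_nearby hU hν.target_mem.1 hν.target_mem.2)
    filter_upwards [this] with s ⟨ν', hν'⟩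
    exact ⟨ν', hν.trans hν'⟩
  have hclosed : IsClosed S := by
    refine ⟨isOpen_iff_mem_nhds.2 fun t ht => ?_⟩
    obtain ⟨ν, hν⟩ := exists_mem_labelledSimple_iff.2 (hg t).2
    have := g.continuous.continuousAt.eventually (exists_joinedIn_nearby hU hν (hg t).1)
    filter_upwards [this] with s ⟨ν', hν'⟩ ⟨τ, hτ⟩
    -- relabelling by `σ` would make `g t` reachable from the reachable point over `g s`
    obtain ⟨σ, rfl⟩ := hν'.target_mem.1.1.exists_perm hτ.target_mem.1.1 hτ.target_mem.1.2
    exact ht ⟨ν ∘ σ, hτ.trans (joinedIn_comp_perm hν' σ).symm⟩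
  have h0 : (0 : unitInterval) ∈ S :=
    ⟨μ, by rw [g.source]; exact JoinedIn.refl ⟨h, by simpa using (hg 0).1⟩⟩
  have h1 : (1 : unitInterval) ∈ S := by
    have hclopen : IsClopen S := ⟨hclosed, hopen⟩
    rw [hclopen.eq_univ ⟨0, h0⟩]
    trivial
  simpa [S] using h1

/-- While the eigenvalues stay in disjoint discs around the points `c i`, none of them can leave its
disc. -/
theorem joinedIn_stays_near {F : Set (Matrix (Fin n) (Fin n) ℂ × (Fin n → ℂ))} {c : Fin n → ℂ}
    {r : ℝ} (hgap : ∀ i j, c i ≠ c j → 2 * r ≤ ‖c i - c j‖)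
    (hF : ∀ p ∈ F, ∀ i, ∃ j, ‖p.2 i - c j‖ < r)
    {p q : Matrix (Fin n) (Fin n) ℂ × (Fin n → ℂ)} (hp : ∀ i, ‖p.2 i - c i‖ < r)
    (h : JoinedIn F p q) : JoinedIn (F ∩ {p | ∀ i, ‖p.2 i - c i‖ < r}) p q := by
  obtain ⟨g, hg⟩ := h
  refine ⟨g, fun t => ⟨hg t, fun i => ?_⟩⟩
  have hcont : Continuous fun t => (g t).2 i := by fun_prop
  have hstart : (Set.range (fun t => (g t).2 i) ∩ Metric.ball (c i) r).Nonempty :=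
    ⟨(g 0).2 i, Set.mem_range_self 0, by rw [g.source]; exact mem_ball_iff_norm.2 (hp i)⟩
  have hsub := (isPreconnected_range hcont).subset_left_of_subset_union
    (u := Metric.ball (c i) r) (v := ⋃ j ∈ {j | c i ≠ c j}, Metric.ball (c j) r)
    Metric.isOpen_ball (isOpen_biUnion fun _ _ => Metric.isOpen_ball) (by
      rw [Set.disjoint_iUnion₂_right]
      intro j hj
      exact Metric.ball_disjoint_ball (by rw [dist_eq_norm]; linarith [hgap i j hj])) (by
      rintro _ ⟨s, rfl⟩
      obtain ⟨j, hj⟩ := hF _ (hg s) i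
      by_cases hij : c i = c j
      · left
        rw [mem_ball_iff_norm, hij]
        exact hj
      · right
        exact Set.mem_biUnion hij (mem_ball_iff_norm.2 hj))
    hstart
  exact mem_ball_iff_norm.1 (hsub ⟨t, rfl⟩)

/-! ### Local joinedness and the approximation of eigenpaths -/

/-- Close to a matrix `A` with labelled spectrum `c`, any two labelled matrices without repeated
eigenvalues are joined. A path avoiding repeated eigenvalues carries both to a matrix `s ν` in
the image of a spectral section, up to a permutation of `ν` preserving the clusters of `c`; that
permutation is undone by moving the points of `ν` and applying the section. -/
theorem IsLabelling.exists_joinedIn {A : Matrix (Fin n) (Fin n) ℂ} {c : Fin n → ℂ}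
    (h : IsLabelling A c) {ε : ℝ} (hε : 0 < ε) :
    ∃ δ > 0, ∀ x ∈ labelledSimple n, ∀ y ∈ labelledSimple n, dist x (A, c) < δ →
      dist y (A, c) < δ → JoinedIn (labelledSimple n ∩ Metric.ball (A, c) ε) x y := by
  obtain ⟨r, hr, hgap⟩ := exists_gap (μ := c)
  let ε' := min ε r
  have hε' : 0 < ε' := lt_min hε hr
  have hgap' : ∀ i j, c i ≠ c j → 2 * ε' ≤ ‖c i - c j‖ := fun i j hij =>
    le_trans (by linarith [min_le_right ε r]) (hgap i j hij)
  obtain ⟨δ₀, hδ₀, hroots⟩ := Metric.eventually_nhds_iff_ball.1 (h.eventually_roots_near hε')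
  let δ := min δ₀ ε'
  have hδ : 0 < δ := lt_min hδ₀ hε'
  obtain ⟨s, hs, hsc, hslab, hsperm⟩ := h.exists_spectral_section hδ
  obtain ⟨δ₁, hδ₁, hδ₁ε, hsδ⟩ : ∃ δ₁ > 0, δ₁ ≤ ε' ∧
      ∀ ν ∈ Metric.ball c δ₁, s ν ∈ Metric.ball A δ := by
    obtain ⟨η, hη, hηs⟩ := Metric.isOpen_iff.1 (Metric.isOpen_ball.preimage hs) c
      (mem_ball_iff_norm.2 hsc)
    exact ⟨min η ε', lt_min hη hε', min_le_right _ _,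
      fun ν hν => hηs (Metric.ball_subset_ball (min_le_left _ _) hν)⟩
  -- both points are joined to the same point of the section
  obtain ⟨ν, hν, hνc⟩ := exists_injective_near c hδ₁
  have main : ∀ x ∈ labelledSimple n, dist x (A, c) < δ →
      JoinedIn (labelledSimple n ∩ Metric.ball (A, c) ε) x (s ν, ν) := by
    rintro ⟨B, μ⟩ hx hxd
    rw [Prod.dist_eq, max_lt_iff] at hxd
    obtain ⟨q, hq⟩ := exists_polynomial_line_separable B (s ν)
    have hline : JoinedIn (Metric.ball A δ ∩ {M | M.charpoly.Separable}) B (s ν) :=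
      joinedIn_of_polynomial_line Metric.isOpen_ball (convex_ball A δ) hxd.1 (hsδ ν hνc) q hq
        (exists_mem_labelledSimple_iff.1 ⟨μ, hx⟩)
        (exists_mem_labelledSimple_iff.1 ⟨ν, hslab ν hν, hν⟩)
    obtain ⟨ν', hj⟩ := exists_joinedIn_of_joinedIn_separable Metric.isOpen_ball hx hline
    have hj' := joinedIn_stays_near hgap' (fun p hp i =>
      hroots p.1 (Metric.ball_subset_ball (min_le_left _ _) hp.2) _ (hp.1.1.isRoot_iff.2 ⟨i, rfl⟩))
      (fun i => by
        rw [← dist_eq_norm]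
        exact (dist_le_pi_dist μ c i).trans_lt (hxd.2.trans_le (min_le_right _ _))) hj
    obtain ⟨σ, rfl⟩ := (hslab ν hν).exists_perm hj'.target_mem.1.1.1 hj'.target_mem.1.1.2
    -- the permutation moves each eigenvalue within its cluster
    have hσ : c ∘ σ = c := by
      funext i
      by_contra hne
      have h1 := hgap' (σ i) i hne
      have h2 : ‖ν (σ i) - c i‖ < ε' := hj'.target_mem.2 i
      have h3 : ‖ν (σ i) - c (σ i)‖ < ε' := by
        rw [← dist_eq_norm]
        exact (dist_le_pi_dist ν c (σ i)).trans_lt (hνc.trans_le hδ₁ε)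
      have h4 := norm_sub_le_norm_sub_add_norm_sub (c (σ i)) (ν (σ i)) (c i)
      rw [norm_sub_rev (c (σ i)) (ν (σ i))] at h4
      linarith
    have hνσ : ν ∘ σ ∈ Metric.ball c δ₁ := by
      rw [Metric.mem_ball, dist_pi_lt_iff hδ₁]
      intro i
      have h3 := (dist_le_pi_dist ν c (σ i)).trans_lt hνc
      rwa [show c (σ i) = c i from congrFun hσ i] at h3
    have hmove := (joinedIn_injective (hν.comp σ.injective) hν hνσ hνc).map
      (f := fun τ => (s τ, τ)) (hs.prodMk continuous_id)
    rw [hsperm] at hmove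
    refine (hj'.mono ?_).trans (hmove.mono ?_)
    · rintro p ⟨⟨hp, hpA⟩, hpc⟩
      refine ⟨hp, ?_⟩
      have hpA' : dist p.1 A < δ := hpA
      rw [Metric.mem_ball, Prod.dist_eq, max_lt_iff]
      refine ⟨hpA'.trans_le ((min_le_right _ _).trans (min_le_left _ _)),
        (dist_pi_lt_iff hε).2 fun i => ?_⟩
      rw [dist_eq_norm]
      exact (hpc i).trans_le (min_le_left _ _)
    · rintro _ ⟨τ, ⟨hτc, hτ⟩, rfl⟩
      have h1 := hsδ τ hτc
      rw [Metric.mem_ball] at h1 hτc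
      refine ⟨⟨hslab τ hτ, hτ⟩, ?_⟩
      rw [Metric.mem_ball, Prod.dist_eq, max_lt_iff]
      exact ⟨h1.trans_le ((min_le_right _ _).trans (min_le_left _ _)),
        hτc.trans_le (hδ₁ε.trans (min_le_left _ _))⟩
  exact ⟨δ, hδ, fun x hx y hy hxd hyd => (main x hx hxd).trans (main y hy hyd).symm⟩

theorem IsLabelling.mem_closure {A : Matrix (Fin n) (Fin n) ℂ} {c : Fin n → ℂ}
    (h : IsLabelling A c) : (A, c) ∈ closure (labelledSimple n) := by
  refine Metric.mem_closure_iff.2 fun ε hε => ?_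
  obtain ⟨s, hs, hsc, hslab, -⟩ := h.exists_spectral_section hε
  obtain ⟨η, hη, hηs⟩ := Metric.isOpen_iff.1 (Metric.isOpen_ball.preimage hs) c
    (mem_ball_iff_norm.2 hsc)
  obtain ⟨ν, hν, hνc⟩ := exists_injective_near c (lt_min hη hε)
  refine ⟨(s ν, ν), ⟨hslab ν hν, hν⟩, ?_⟩
  rw [dist_comm, Prod.dist_eq, max_lt_iff]
  exact ⟨hηs (Metric.mem_ball.2 (hνc.trans_le (min_le_left _ _))), hνc.trans_le (min_le_right _ _)⟩

/-- An eigenpath-labelled matrix path is a uniform limit of labelled matrix paths without repeated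
eigenvalues. -/
theorem exists_simple_path_near (M : MatrixPath n) (γ : Fin n → C(unitInterval, ℂ))
    (h : ∀ α, IsLabelling (M α) fun i => γ i α) {ε : ℝ} (hε : 0 < ε) :
    ∃ (M' : MatrixPath n) (γ' : Fin n → C(unitInterval, ℂ)),
      (∀ α, (M' α, fun i => γ' i α) ∈ labelledSimple n) ∧ IsUniformlyClose ε M M' ∧
      ∀ j α, ‖γ j α - γ' j α‖ < ε := by
  have hcont : Continuous fun α => (M α, fun i => γ i α) :=
    M.continuous.prodMk (continuous_pi fun i => (γ i).continuous)
  obtain ⟨g, hgX, hgε⟩ := exists_path_approx (labelledSimple n) ⟨_, hcont⟩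
    (fun α => (h α).mem_closure) (fun α ε hε => (h α).exists_joinedIn hε) hε
  have hd : ∀ α, dist (M α) (g α).1 < ε ∧ dist (fun i => γ i α) (g α).2 < ε := fun α =>
    max_lt_iff.1 (hgε α)
  refine ⟨⟨fun α => (g α).1, continuous_fst.comp g.continuous⟩,
    fun i => ⟨fun α => (g α).2 i, (continuous_apply i).comp (continuous_snd.comp g.continuous)⟩,
    hgX, fun α => ?_, fun j α => ?_⟩
  · rw [← dist_eq_norm]
    exact (hd α).1
  · rw [← dist_eq_norm]
    exact (dist_le_pi_dist _ _ j).trans_lt (hd α).2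

/-! ### Uniqueness of the eigenpath set -/

theorem map_eval_pathMultiset (γ : Fin n → C(unitInterval, ℂ)) (α : unitInterval) :
    (pathMultiset γ).map (fun g => g α) = (Finset.univ : Finset (Fin n)).val.map fun i => γ i α := by
  rw [pathMultiset, Multiset.map_map]
  rfl

/-- A continuous function whose value at every time is one of the pairwise distinct values of the
paths `γ i` is one of these paths. -/
theorem exists_eq_of_forall_exists_eq {γ : Fin n → C(unitInterval, ℂ)}
    (hγ : ∀ α, Function.Injective fun i => γ i α) (g : C(unitInterval, ℂ))
    (hg : ∀ α, ∃ i, g α = γ i α) : ∃ i, g = γ i := by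
  let Z : Fin n → Set unitInterval := fun i => {α | g α = γ i α}
  have hZ : ∀ i, IsClosed (Z i) := fun i => isClosed_eq g.continuous (γ i).continuous
  have hcompl : ∀ i, (Z i)ᶜ = ⋃ j ∈ {j | j ≠ i}, Z j := by
    intro i
    ext α
    simp only [Set.mem_iUnion, Set.mem_compl_iff]
    constructor
    · intro hα
      obtain ⟨j, hj⟩ := hg α
      exact ⟨j, fun hji => hα (hji ▸ hj), hj⟩
    · rintro ⟨j, hji, hj⟩ hi
      exact hji (hγ α (hj.symm.trans hi))
  obtain ⟨i, hi⟩ := hg 0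
  refine ⟨i, ?_⟩
  have hopen : IsOpen (Z i) := by
    rw [← isClosed_compl_iff, hcompl]
    exact (Set.toFinite _).isClosed_biUnion fun j _ => hZ j
  have huniv := IsClopen.eq_univ ⟨hZ i, hopen⟩ ⟨0, hi⟩
  ext α
  exact huniv.symm.subset (Set.mem_univ α)

theorem IsEigenpathSet.eq_pathMultiset {C' : MatrixPath n} {γ : Fin n → C(unitInterval, ℂ)}
    (hγ : ∀ α, (C' α, fun i => γ i α) ∈ labelledSimple n) {Γ : Multiset C(unitInterval, ℂ)}
    (hΓ : IsEigenpathSet C' Γ) : Γ = pathMultiset γ := by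
  have hmap : ∀ α, Γ.map (fun g => g α) =
      (Finset.univ : Finset (Fin n)).val.map fun i => γ i α := fun α => by
    rw [← hΓ.2 α, multisetSpectrum]
    exact isLabelling_iff_roots.1 (hγ α).1
  have hnodup : Γ.Nodup := by
    refine Multiset.Nodup.of_map (fun g => g 0) ?_
    rw [hmap 0]
    exact Finset.univ.nodup.map (hγ 0).2
  refine Multiset.eq_of_le_of_card_le ((Multiset.le_iff_subset hnodup).2 fun g hg => ?_) ?_
  · obtain ⟨i, rfl⟩ := exists_eq_of_forall_exists_eq (fun α => (hγ α).2) g fun α => by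
      have : g α ∈ Γ.map (fun g => g α) := Multiset.mem_map_of_mem _ hg
      rw [hmap α] at this
      obtain ⟨i, -, hi⟩ := Multiset.mem_map.1 this
      exact ⟨i, hi.symm⟩
    exact Multiset.mem_map_of_mem _ (Finset.mem_univ i)
  · rw [hΓ.1]
    simp [pathMultiset]

end Eigenpath

theorem theorem2 (n : ℕ) (ε : ℝ) (hε : 0 < ε) (C : Eigenpath.MatrixPath n)
    (γ : Fin n → C(unitInterval, ℂ))
    (hγ : Eigenpath.IsEigenpathSet C (Eigenpath.pathMultiset γ)) :
    ∃ (C' : Eigenpath.MatrixPath n) (γ' : Fin n → C(unitInterval, ℂ)),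
      Eigenpath.IsEigenpathSet C' (Eigenpath.pathMultiset γ') ∧
      (∀ Γ : Multiset C(unitInterval, ℂ),
        Eigenpath.IsEigenpathSet C' Γ → Γ = Eigenpath.pathMultiset γ') ∧
      (∀ p : ℂ × unitInterval, ¬ Eigenpath.IsAmbiguity C' p) ∧
      Eigenpath.IsUniformlyClose ε C C' ∧
      (∀ (j : Fin n) (α : unitInterval), ‖γ j α - γ' j α‖ < ε) := by
  have hlab : ∀ α, Eigenpath.IsLabelling (C α) fun i => γ i α := fun α => by
    rw [Eigenpath.isLabelling_iff_roots, ← Eigenpath.map_eval_pathMultiset]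
    exact hγ.2 α
  obtain ⟨C', γ', hX, hC, hclose⟩ := Eigenpath.exists_simple_path_near C γ hlab hε
  have hroots : ∀ α, Eigenpath.multisetSpectrum (C' α) = Finset.univ.val.map fun i => γ' i α :=
    fun α => Eigenpath.isLabelling_iff_roots.1 (hX α).1
  refine ⟨C', γ', ⟨by simp [Eigenpath.pathMultiset], fun α => ?_⟩,
    fun Γ hΓ => hΓ.eq_pathMultiset hX, ?_, hC, hclose⟩
  · rw [Eigenpath.map_eval_pathMultiset, hroots]
  · rintro ⟨z, α⟩ ⟨-, h2⟩
    have hnodup : (Eigenpath.multisetSpectrum (C' α)).Nodup := by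
      rw [hroots]
      exact Finset.univ.nodup.map (hX α).2
    exact absurd (Multiset.nodup_iff_count_le_one.1 hnodup z) (not_le.2 h2)
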